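/- Let $n_1\ge 1$, $n_2\ge 0$, $s\ge 0$ be integers, $n=n_1+2n_2+s$, and identify $\mathbb F_3^{n}=\mathbb F_3^{n_1}\times\mathbb F_3^{n_2}\times\mathbb F_3^{n_2}\times\mathbb F_3^{s}$, with standard basis $e_1,\dots,e_n$ and inner product $\langle a,b\rangle=\sum_i a_ib_i$. Let $u_1,\dots,u_{n_1},v_1,\dots,v_{n_1}\in\mathbb F_3^*$ and let $f:\mathbb F_3^n\to\mathbb F_3$ be the function $$f(x,y,z,t)=f^{(z)}(x)+\sum_{i=1}^{n_2}y_iz_i,\qquad f^{(0)}(x)=\sum_{i=1}^{n_1}u_ix_i^2,\qquad f^{(z)}(x)=\sum_{i=1}^{n_1}v_ix_i^2\ \text{ for } z\ne 0 .$$ When $n+s$ is even, let $\epsilon_0\in\{1,-1\}$ be the sign for which $\sum_{w\in\mathbb F_3^n}\xi^{f(w)}=\epsilon_0\,3^{(n+s)/2}\,\xi^{j}$ for some $j\in\mathbb F_3$, where $\xi=e^{2\pi\sqrt{-1}/3}$. Let $T$ be any set of nonzero zeros of $f$ that contains exactly one vector out of each pair $\{w,-w\}$ of nonzero zeros of $f$.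 Put $\alpha_i=e_i$ for $1\le i\le n_1$ and $\alpha_i=e_1+e_i$ for $n_1<i\le n$, let $H^{(1)}=(\langle\alpha_i,\alpha_j\rangle)_{1\le i,j\le n}$, let $G=(\langle \alpha_i,w\rangle)_{1\le i\le n,\ w\in T}$, and let $\mathcal C$ be the ternary linear code spanned by the rows of $G'=[H^{(1)},G]$. For a linear code, $[N,k]$ (resp. $[N,k,d]$) means length $N$ and dimension $k$ (resp. and minimum Hamming distance $d$), $\perp$ is the Euclidean dual, and a code $\mathcal D$ is LCD if $\mathcal D\cap\mathcal D^{\perp}=\{0\}$. (i) If $n+s$ is even, $0\le s\le n-4$ and $n+s\ge 6$, put $m=\frac{3^{n-1}+2\epsilon_0 3^{\frac{n+s}{2}-1}-1}{2}$. (ii) If $n+s$ is odd, $0\le s\le n-3$ and $n+s\ge 5$, put $m=\frac{3^{n-1}-1}{2}$. In both cases $m$ is a non-negative integer, $G$ is a generator matrix of the code $\widetilde{\mathcal C}_{D_{f,0}\setminus\{0\}}=\{(\langle a,w\rangle)_{w\in T}: a\in\mathbb F_3^n\}$ (its rows form a basis of this code), $G'$ is a generator matrix of $\mathcal C$, the code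 $\mathcal C$ is an LCD code with parameters $[m+n,\,n]$, and its dual $\mathcal C^{\perp}$ is an LCD code with parameters $[m+n,\,m,\,3]$. -/

import Mathlib

open scoped Matrix

namespace PlateauedLCD

noncomputable section

/-! ### Linear codes -/

section Codes

variable {F ι κ : Type*} [Field F] [Fintype ι]

/-- The (Euclidean) dual code of a linear code whose coordinates are indexed by `ι`. -/
def dualCode (C : Submodule F (ι → F)) : Submodule F (ι → F) where
  carrier := {x | ∀ y ∈ C, x ⬝ᵥ y = 0}
  zero_mem' := fun y _ => zero_dotProduct y
  add_mem' := fun {a b} ha hb y hy => by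
    rw [add_dotProduct, ha y hy, hb y hy, add_zero]
  smul_mem' := fun c x hx y hy => by
    rw [smul_dotProduct, hx y hy, smul_zero]

/-- A linear complementary dual (LCD) code. -/
def IsLCD (C : Submodule F (ι → F)) : Prop :=
  C ⊓ dualCode C = ⊥

/-- `C` is an `[N, k]` linear code. -/
def HasParams (C : Submodule F (ι → F)) (N k : ℕ) : Prop :=
  Fintype.card ι = N ∧ Module.finrank F C = k

/-- `d` is the minimum Hamming distance of `C`. -/
def IsMinDist [DecidableEq F] (C : Submodule F (ι → F)) (d : ℕ) : Prop :=
  IsLeast {w : ℕ | ∃ x ∈ C, ∃ y ∈ C, x ≠ y ∧ hammingDist x y = w} d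

/-- The linear code spanned by the rows of a matrix. -/
def rowCode (G : Matrix κ ι F) : Submodule F (ι → F) :=
  Submodule.span F (Set.range G.row)

/-- `G` is a generator matrix of `C`: its rows form a basis of `C`. -/
def IsGeneratorMatrix (G : Matrix κ ι F) (C : Submodule F (ι → F)) : Prop :=
  LinearIndependent F G.row ∧ rowCode G = C

end Codes

/-! ### Walsh transform and signs of Walsh coefficients -/

section Walsh

variable {p : ℕ} [NeZero p] {ι : Type*} [Fintype ι] [DecidableEq ι]

/-- The Walsh transform of a `p`-ary function on `𝔽_p ^ ι`;
`ZMod.stdAddChar j` is `exp (2 π i j / p)`. -/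
def walsh (f : (ι → ZMod p) → ZMod p) (α : ι → ZMod p) : ℂ :=
  ∑ x : ι → ZMod p, ZMod.stdAddChar (f x - α ⬝ᵥ x)

/-- `μ = 1` if `p ^ (n + s) ≡ 1 (mod 4)` and `μ = √-1` otherwise
(that is, if `p ^ (n + s) ≡ 3 (mod 4)`, for odd `p`). -/
def mu (p n s : ℕ) : ℂ :=
  if p ^ (n + s) % 4 = 1 then 1 else Complex.I

/-- The number `p ^ ((n + s) / 2)`, with `n` the dimension of the domain. -/
def amplitude (p n s : ℕ) : ℂ :=
  (((p : ℝ) ^ (((n : ℝ) + (s : ℝ)) / 2) : ℝ) : ℂ)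

/-- The set `B₊(f)` of an `s`-plateaued function `f`; the exponent `j` is the value at `α` of the
dual of `f`. -/
def BPlus (f : (ι → ZMod p) → ZMod p) (s : ℕ) : Set (ι → ZMod p) :=
  {α | ∃ j : ZMod p, walsh f α =
    mu p (Fintype.card ι) s * amplitude p (Fintype.card ι) s * ZMod.stdAddChar j}

/-- The set `B₋(f)` of an `s`-plateaued function `f`. -/
def BMinus (f : (ι → ZMod p) → ZMod p) (s : ℕ) : Set (ι → ZMod p) :=
  {α | ∃ j : ZMod p, walsh f α =
    -(mu p (Fintype.card ι) s * amplitude p (Fintype.card ι) s * ZMod.stdAddChar j)}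

open scoped Classical in
/-- The sign `ε_α` of an `s`-plateaued function: `1` on `B₊(f)` and `-1` on `B₋(f)`
(and `0` outside the Walsh support, where the sign is not defined). -/
def walshSign (f : (ι → ZMod p) → ZMod p) (s : ℕ) (α : ι → ZMod p) : ℤ :=
  if α ∈ BPlus f s then 1 else if α ∈ BMinus f s then -1 else 0

end Walsh

/-! ### Defining-set codes -/

section DefiningSet

variable {F ι : Type*} [Field F] [Fintype ι]

/-- `D_{f,0} \ {0}`: the nonzero zeros of `f`. -/
def nonzeroZeros (f : (ι → F) → F) : Set (ι → F) :=
  {x | f x = 0 ∧ x ≠ 0}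

/-- `T` is a choice of representatives of `D` up to nonzero scalars:
the sets `a T`, `a ∈ F \ {0}`, are pairwise disjoint with union `D`. -/
def IsScalarTransversal (T D : Set (ι → F)) : Prop :=
  (∀ a b : F, a ≠ 0 → b ≠ 0 → a ≠ b →
    Disjoint ((fun x => a • x) '' T) ((fun x => b • x) '' T)) ∧
  (⋃ a ∈ {a : F | a ≠ 0}, (fun x => a • x) '' T) = D

/-- The linear code with defining set `T`, consisting of the words `(⟨a, x⟩)_{x ∈ T}`. -/
def definingSetCode (T : Finset (ι → F)) : Submodule F (T → F) where
  carrier := {c | ∃ a : ι → F, c = fun x => a ⬝ᵥ x.1}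
  zero_mem' := ⟨0, by funext x; simp⟩
  add_mem' := by
    rintro _ _ ⟨a, rfl⟩ ⟨b, rfl⟩
    exact ⟨a + b, by funext x; simp [add_dotProduct]⟩
  smul_mem' := by
    rintro c _ ⟨a, rfl⟩
    exact ⟨c • a, by funext x; simp [smul_dotProduct]⟩

variable {κ : Type*}

/-- The matrix with rows `(⟨α_i, x⟩)_{x ∈ T}`. -/
def definingSetMatrix (α : κ → ι → F) (T : Finset (ι → F)) : Matrix κ T F :=
  Matrix.of fun i x => α i ⬝ᵥ x.1

/-- The Gram matrix `(⟨α_i, α_j⟩)`. -/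
def gram (α : κ → ι → F) : Matrix κ κ F :=
  Matrix.of fun i j => α i ⬝ᵥ α j

end DefiningSet

/-! ### The quadratic plateaued functions -/

/-- Coordinates of `𝔽^{n₁} × 𝔽^{n₂} × 𝔽^{n₂} × 𝔽^s`, in this order. -/
abbrev Coord (n₁ n₂ s : ℕ) : Type :=
  Fin n₁ ⊕ (Fin n₂ ⊕ (Fin n₂ ⊕ Fin s))

section Quadratic

variable {F : Type*} [Field F] [DecidableEq F] {n₁ n₂ s : ℕ}

/-- The coordinates `x ∈ 𝔽^{n₁}` of a vector. -/
def xPart (w : Coord n₁ n₂ s → F) : Fin n₁ → F := fun i => w (Sum.inl i)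

/-- The coordinates `y ∈ 𝔽^{n₂}` of a vector. -/
def yPart (w : Coord n₁ n₂ s → F) : Fin n₂ → F := fun i => w (Sum.inr (Sum.inl i))

/-- The coordinates `z ∈ 𝔽^{n₂}` of a vector. -/
def zPart (w : Coord n₁ n₂ s → F) : Fin n₂ → F := fun i => w (Sum.inr (Sum.inr (Sum.inl i)))

/-- `f^{(z)}(x) = ∑ uᵢ xᵢ²` for `z = 0`, and `f^{(z)}(x) = ∑ vᵢ xᵢ²` for `z ≠ 0`. -/
def diagForm (u v : Fin n₁ → F) (z : Fin n₂ → F) (x : Fin n₁ → F) : F :=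
  if z = 0 then ∑ i, u i * x i ^ 2 else ∑ i, v i * x i ^ 2

/-- `f(x, y, z, t) = f^{(z)}(x) + ∑ yᵢ zᵢ`. -/
def quadPlateaued (s : ℕ) (u v : Fin n₁ → F) (n₂ : ℕ) (w : Coord n₁ n₂ s → F) : F :=
  diagForm u v (zPart w) (xPart w) + ∑ i, yPart w i * zPart w i

/-- The basis `α_i = e_i` for `i ≤ n₁` and `α_i = e_1 + e_i` for `i > n₁`. -/
def alpha (F : Type*) [Field F] (n₁ n₂ s : ℕ) [NeZero n₁] (i : Coord n₁ n₂ s) :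
    Coord n₁ n₂ s → F :=
  match i with
  | Sum.inl k => Pi.single (Sum.inl k) 1
  | Sum.inr k => Pi.single (Sum.inl 0) 1 + Pi.single (Sum.inr k) 1

end Quadratic

end

end PlateauedLCD

namespace PlateauedLCD

/-! ### Codes spanned by the rows of a matrix -/

section RowCode

variable {F ι κ : Type*} [Field F] [Fintype κ]

/-! Let `A` be the invertible matrix with rows `α_i` and `P` the matrix with the points of `T` as
columns. Then `G' = A [Aᵀ | P]`, so `G'` and `[Aᵀ | P]` have the same row space and the same kernel.

LCD: it suffices that `G' G'ᵀ = A (AᵀA + P Pᵀ) Aᵀ` is invertible, and this holds because `P Pᵀ = 0`,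
i.e. the second moments of the zero set of `f` vanish mod 3 (`sum_zeros_mul_eq_zero`). The zero set
has indicator `1 - f²`, and a Chevalley–Warning argument applies once the coordinates are weighted
so that the switch on `z` costs no degree; it needs `n + s = n₁ + 2n₂ + 2s ≥ 5`.

Dimension: the zeros of `f` span the space when `n - s = n₁ + 2n₂ ≥ 3`
(`eq_zero_of_dotProduct_zeros`), so `P` already has independent rows.

Dual distance: `[Aᵀ | P]` is a parity-check matrix of the dual. No two of its columns are
proportional, since `f` vanishes on `T` but not at the `α_i`, and `T` contains no pair `±w`;
explicit zeros of `f` give three dependent columns.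

Length: `2|T| + 1` is the number of zeros, which is computed from the Walsh value at `0`. That value
is a power of 3 times a product of `n₁` quadratic Gauss sums, each purely imaginary with square
`-3`, so the parity of `n₁` (that of `n + s`) decides between the two formulas. -/

theorem mem_rowCode {G : Matrix κ ι F} {x : ι → F} :
    x ∈ rowCode G ↔ ∃ c : κ → F, c ᵥ* G = x := by
  rw [rowCode, ← range_vecMulLinear]
  simp

theorem IsGeneratorMatrix.finrank {G : Matrix κ ι F} {C : Submodule F (ι → F)}
    (h : IsGeneratorMatrix G C) : Module.finrank F C = Fintype.card κ := by
  rw [← h.2]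
  exact finrank_span_eq_card h.1

theorem linearIndependent_row_mul [DecidableEq κ] {A : Matrix κ κ F} (hA : IsUnit A)
    {B : Matrix κ ι F} (hB : LinearIndependent F B.row) : LinearIndependent F (A * B).row := by
  rw [← Matrix.vecMul_injective_iff] at hB ⊢
  intro c d hcd
  simp only [← Matrix.vecMul_vecMul] at hcd
  exact Matrix.vecMul_injective_iff_isUnit.2 hA (hB hcd)

theorem rowCode_mul [DecidableEq κ] {A : Matrix κ κ F} (hA : IsUnit A) (B : Matrix κ ι F) :
    rowCode (A * B) = rowCode B := by
  ext x
  simp only [mem_rowCode, ← Matrix.vecMul_vecMul]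
  constructor
  · rintro ⟨c, rfl⟩
    exact ⟨_, rfl⟩
  · rintro ⟨c, rfl⟩
    obtain ⟨d, rfl⟩ := Matrix.vecMul_surjective_iff_isUnit.2 hA c
    exact ⟨d, rfl⟩

end RowCode

/-! ### Duals of linear codes -/

section Codes

variable {F ι κ : Type*} [Field F] [Fintype ι]

theorem mem_dualCode {C : Submodule F (ι → F)} {x : ι → F} :
    x ∈ dualCode C ↔ ∀ y ∈ C, x ⬝ᵥ y = 0 :=
  Iff.rfl

theorem dualCode_eq_comap_dualAnnihilator [DecidableEq ι] (C : Submodule F (ι → F)) :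
    dualCode C = C.dualAnnihilator.comap (dotProductEquiv F ι).toLinearMap := by
  ext x
  simp [mem_dualCode, Submodule.mem_dualAnnihilator]

theorem finrank_add_finrank_dualCode (C : Submodule F (ι → F)) :
    Module.finrank F C + Module.finrank F (dualCode C) = Fintype.card ι := by
  classical
  rw [dualCode_eq_comap_dualAnnihilator, Submodule.comap_equiv_eq_map_symm,
    LinearEquiv.finrank_map_eq, Subspace.finrank_add_finrank_dualAnnihilator_eq,
    Module.finrank_fintype_fun_eq_card]

theorem dualCode_dualCode (C : Submodule F (ι → F)) : dualCode (dualCode C) = C := by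
  have hle : C ≤ dualCode (dualCode C) := fun x hx y hy => by
    rw [dotProduct_comm]
    exact hy x hx
  refine (Submodule.eq_of_le_of_finrank_eq hle ?_).symm
  have h₁ := finrank_add_finrank_dualCode C
  have h₂ := finrank_add_finrank_dualCode (dualCode C)
  omega

theorem IsLCD.dualCode {C : Submodule F (ι → F)} (hC : IsLCD C) :
    IsLCD (PlateauedLCD.dualCode C) := by
  rw [IsLCD, dualCode_dualCode, inf_comm]
  exact hC

theorem mem_dualCode_rowCode [Fintype κ] {G : Matrix κ ι F} {x : ι → F} :
    x ∈ dualCode (rowCode G) ↔ G *ᵥ x = 0 := by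
  constructor
  · intro h
    funext i
    change G.row i ⬝ᵥ x = 0
    rw [dotProduct_comm]
    exact h _ (Submodule.subset_span ⟨i, rfl⟩)
  · rintro h y hy
    obtain ⟨c, rfl⟩ := mem_rowCode.1 hy
    rw [dotProduct_comm, ← Matrix.dotProduct_mulVec, h, dotProduct_zero]

/-- Massey's criterion: a word `c ᵥ* G` orthogonal to every row satisfies `G Gᵀ c = 0`. -/
theorem isLCD_rowCode [Fintype κ] [DecidableEq κ] {G : Matrix κ ι F} (hG : IsUnit (G * Gᵀ)) :
    IsLCD (rowCode G) := by
  rw [IsLCD, eq_bot_iff]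
  rintro x ⟨hx, hx'⟩
  obtain ⟨c, rfl⟩ := mem_rowCode.1 hx
  have h := mem_dualCode_rowCode.1 hx'
  rw [← Matrix.mulVec_transpose, Matrix.mulVec_mulVec] at h
  have hc : c = 0 := Matrix.mulVec_injective_iff_isUnit.2 hG (by rw [h, Matrix.mulVec_zero])
  simp [hc]

/-- A code with parity-check matrix `B` has minimum distance `3` if any two columns of `B` are
linearly independent and some three columns are dependent. -/
theorem isMinDist_three [DecidableEq F] [DecidableEq ι] [Nontrivial ι]
    {C : Submodule F (ι → F)} {B : Matrix κ ι F}
    (hC : ∀ x, x ∈ C ↔ B *ᵥ x = 0)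
    (hpair : ∀ i j, i ≠ j → ∀ a b : F, a • B.col i + b • B.col j = 0 → a = 0 ∧ b = 0)
    (htriple : ∃ i j k : ι, i ≠ j ∧ i ≠ k ∧ ∃ a b c : F, a ≠ 0 ∧
      a • B.col i + b • B.col j + c • B.col k = 0) :
    IsMinDist C 3 := by
  have hlow : ∀ x ∈ C, x ≠ 0 → 3 ≤ hammingNorm x := by
    intro x hx hx0
    by_contra hlt
    have hcard : (Finset.univ.filter fun i => x i ≠ 0).card ≤ 2 := by
      rw [hammingNorm] at hlt
      omega
    -- A support of size one is padded by an arbitrary second position; this is where `Nontrivial ι`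
    -- enters.
    obtain ⟨i, j, hij, hsub⟩ : ∃ i j : ι, i ≠ j ∧ ∀ k, x k ≠ 0 → k = i ∨ k = j := by
      obtain ⟨i, hi⟩ := Function.ne_iff.1 hx0
      by_cases h : ∃ j, j ≠ i ∧ x j ≠ 0
      · obtain ⟨j, hji, hj⟩ := h
        refine ⟨i, j, hji.symm, fun k hk => ?_⟩
        by_contra hne
        push Not at hne
        have h3 : ({i, j, k} : Finset ι).card = 3 :=
          Finset.card_eq_three.2 ⟨i, j, k, hji.symm, hne.1.symm, hne.2.symm, rfl⟩
        have hsub : ({i, j, k} : Finset ι) ⊆ Finset.univ.filter fun i => x i ≠ 0 := by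
          intro l hl
          simp only [Finset.mem_insert, Finset.mem_singleton] at hl
          rcases hl with rfl | rfl | rfl <;> simpa
        have := Finset.card_le_card hsub
        omega
      · push Not at h
        obtain ⟨j, hj⟩ := exists_ne i
        exact ⟨i, j, hj.symm, fun k hk => Or.inl (by_contra fun hki => hk (h k hki))⟩
    have hx' : x = Pi.single i (x i) + Pi.single j (x j) := by
      funext k
      by_cases hki : k = i
      · subst hki
        simp [hij]
      · by_cases hkj : k = j
        · subst hkj
          simp [hki]
        · have : x k = 0 := by
            by_contra hk
            rcases hsub k hk with h | h <;> contradiction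
          simp [hki, hkj, this]
    have hB := (hC x).1 hx
    rw [hx', Matrix.mulVec_add, Matrix.mulVec_single, Matrix.mulVec_single] at hB
    obtain ⟨ha, hb⟩ := hpair i j hij (x i) (x j) (by simpa using hB)
    exact hx0 (by rw [hx', ha, hb]; simp)
  obtain ⟨i, j, k, hij, hik, a, b, c, ha, habc⟩ := htriple
  -- Only `a ≠ 0` and `i ∉ {j, k}` matter: they make `y` nonzero of weight at most 3, and the lower
  -- bound does the rest.
  set y : ι → F := Pi.single i a + Pi.single j b + Pi.single k c with hy
  have hyC : y ∈ C := by
    rw [hC, hy, Matrix.mulVec_add, Matrix.mulVec_add, Matrix.mulVec_single, Matrix.mulVec_single,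
      Matrix.mulVec_single]
    simpa using habc
  have hy0 : y ≠ 0 := by
    intro h
    have := congrFun h i
    simp [hy, hij, hik] at this
    exact ha this
  have hyle : hammingNorm y ≤ 3 := by
    have hsub : (Finset.univ.filter fun l => y l ≠ 0) ⊆ {i, j, k} := by
      intro l hl
      by_contra hne
      simp only [Finset.mem_insert, Finset.mem_singleton, not_or] at hne
      simp [hy, hne] at hl
    exact (Finset.card_le_card hsub).trans Finset.card_le_three
  constructor
  · refine ⟨y, hyC, 0, C.zero_mem, hy0, ?_⟩
    rw [hammingDist_zero_right]
    exact le_antisymm hyle (hlow y hyC hy0)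
  · rintro w ⟨x, hx, z, hz, hxz, rfl⟩
    rw [hammingDist_comm, hammingDist_eq_hammingNorm, neg_add_eq_sub]
    exact hlow _ (C.sub_mem hx hz) (sub_ne_zero.2 hxz)

end Codes

/-! ### Polynomial functions of bounded weighted degree -/

section WeightedDegree

open MvPolynomial

variable {σ F : Type*} [Field F]

/-- `g` is a polynomial function of weighted degree at most `d`. -/
def WeightedDegreeLE (wt : σ → ℕ) (d : ℕ) (g : (σ → F) → F) : Prop :=
  ∃ P : MvPolynomial σ F, (∀ e ∈ P.support, Finsupp.weight wt e ≤ d) ∧ ∀ x, eval x P = g x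

namespace WeightedDegreeLE

variable {wt : σ → ℕ} {d d' : ℕ} {g h : (σ → F) → F}

theorem mono (hg : WeightedDegreeLE wt d g) (hd : d ≤ d') : WeightedDegreeLE wt d' g := by
  obtain ⟨P, hP, hPg⟩ := hg
  exact ⟨P, fun e he => (hP e he).trans hd, hPg⟩

theorem const (c : F) : WeightedDegreeLE wt d (fun _ : σ → F => c) := by
  classical
  refine ⟨C c, fun e he => ?_, fun x => eval_C c⟩
  rw [mem_support_iff, coeff_C] at he
  have : e = 0 := by
    by_contra hne
    exact he (if_neg (Ne.symm hne))
  simp [this]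

theorem coord (i : σ) : WeightedDegreeLE wt (wt i) (fun x : σ → F => x i) := by
  refine ⟨X i, fun e he => ?_, fun x => eval_X i⟩
  rw [support_X, Finset.mem_singleton] at he
  subst he
  simp [Finsupp.weight_single]

theorem add (hg : WeightedDegreeLE wt d g) (hh : WeightedDegreeLE wt d h) :
    WeightedDegreeLE wt d (fun x => g x + h x) := by
  classical
  obtain ⟨P, hP, hPg⟩ := hg
  obtain ⟨Q, hQ, hQh⟩ := hh
  refine ⟨P + Q, fun e he => ?_, fun x => by rw [map_add, hPg, hQh]⟩
  rcases Finset.mem_union.1 (support_add he) with h | h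
  · exact hP e h
  · exact hQ e h

theorem mul (hg : WeightedDegreeLE wt d g) (hh : WeightedDegreeLE wt d' h) :
    WeightedDegreeLE wt (d + d') (fun x => g x * h x) := by
  classical
  obtain ⟨P, hP, hPg⟩ := hg
  obtain ⟨Q, hQ, hQh⟩ := hh
  refine ⟨P * Q, fun e he => ?_, fun x => by rw [map_mul, hPg, hQh]⟩
  obtain ⟨a, ha, b, hb, rfl⟩ := Finset.mem_add.1 (support_mul P Q he)
  rw [map_add]
  exact add_le_add (hP a ha) (hQ b hb)

theorem const_mul (c : F) (hg : WeightedDegreeLE wt d g) :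
    WeightedDegreeLE wt d (fun x => c * g x) :=
  ((const (d := 0) c).mul hg).mono (zero_add d).le

theorem sum {τ : Type*} (s : Finset τ) {g : τ → (σ → F) → F}
    (hg : ∀ i ∈ s, WeightedDegreeLE wt d (g i)) :
    WeightedDegreeLE wt d (fun x => ∑ i ∈ s, g i x) := by
  classical
  induction s using Finset.induction_on with
  | empty => simpa using const (0 : F)
  | insert a s ha ih =>
    simp only [Finset.sum_insert ha]
    exact (hg a (by simp)).add (ih fun i hi => hg i (by simp [hi]))

/-- Degree 0 is the bound that survives products of any length; it serves the indicator of `z = 0`.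
-/
theorem prod_zero {τ : Type*} (s : Finset τ) {g : τ → (σ → F) → F}
    (hg : ∀ i ∈ s, WeightedDegreeLE wt 0 (g i)) :
    WeightedDegreeLE wt 0 (fun x => ∏ i ∈ s, g i x) := by
  classical
  induction s using Finset.induction_on with
  | empty => simpa using const (1 : F)
  | insert a s ha ih =>
    simp only [Finset.prod_insert ha]
    exact (hg a (by simp)).mul (ih fun i hi => hg i (by simp [hi]))

/-- The Chevalley–Warning vanishing of sums, for a weighted degree. -/
theorem sum_eq_zero [Fintype σ] [DecidableEq σ] [Fintype F]
    (hg : WeightedDegreeLE wt d g) (hd : d < (Fintype.card F - 1) * ∑ i, wt i) :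
    ∑ x, g x = 0 := by
  classical
  obtain ⟨P, hP, hPg⟩ := hg
  simp only [← hPg, eval_eq']
  rw [Finset.sum_comm]
  refine Finset.sum_eq_zero fun e he => ?_
  rw [← Finset.mul_sum, ← Fintype.prod_sum fun i (a : F) => a ^ e i]
  -- If all exponents were at least `q - 1`, the monomial would have weight at least `(q - 1) ∑ wt`.
  -- A coordinate with a smaller exponent has vanishing power sum.
  obtain ⟨i, hi⟩ : ∃ i, e i < Fintype.card F - 1 := by
    by_contra! hall
    refine absurd (hP e he) (not_le.2 (hd.trans_le ?_))
    rw [Finsupp.weight_eq_sum, Finset.mul_sum]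
    exact Finset.sum_le_sum fun i _ => Nat.mul_le_mul_right _ (hall i)
  rw [Finset.prod_eq_zero (Finset.mem_univ i) (FiniteField.sum_pow_lt_card_sub_one F (e i) hi),
    mul_zero]

end WeightedDegreeLE

end WeightedDegree

/-! ### The number of zeros of the quadratic plateaued functions -/

section CharacterSum

variable {n₁ n₂ s : ℕ}

theorem sum_coord {F M : Type*} [Fintype F] [DecidableEq F] [AddCommMonoid M]
    (g : (Coord n₁ n₂ s → F) → M) :
    ∑ w, g w = ∑ x, ∑ y, ∑ z, ∑ t, g (Sum.elim x (Sum.elim y (Sum.elim z t))) := by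
  rw [← (Equiv.sumArrowEquivProdArrow _ _ F).symm.sum_comp, Fintype.sum_prod_type]
  refine Finset.sum_congr rfl fun x _ => ?_
  rw [← (Equiv.sumArrowEquivProdArrow _ _ F).symm.sum_comp, Fintype.sum_prod_type]
  refine Finset.sum_congr rfl fun y _ => ?_
  rw [← (Equiv.sumArrowEquivProdArrow _ _ F).symm.sum_comp, Fintype.sum_prod_type]
  rfl

theorem quadPlateaued_sumElim {F : Type*} [Field F] [DecidableEq F] (u v x : Fin n₁ → F)
    (y z : Fin n₂ → F) (t : Fin s → F) :
    quadPlateaued s u v n₂ (Sum.elim x (Sum.elim y (Sum.elim z t))) =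
      diagForm u v z x + ∑ i, y i * z i :=
  rfl

theorem isPrimitive_stdAddChar_three : (ZMod.stdAddChar (N := 3)).IsPrimitive :=
  ZMod.isPrimitive_stdAddChar 3

theorem addChar_map_sum {A M ι : Type*} [AddCommMonoid A] [CommMonoid M]
    (ψ : AddChar A M) (s : Finset ι) (g : ι → A) : ψ (∑ i ∈ s, g i) = ∏ i ∈ s, ψ (g i) :=
  map_prod ψ.toMonoidHom (fun i => Multiplicative.ofAdd (g i)) s

theorem sum_stdAddChar_dot (z : Fin n₂ → ZMod 3) :
    ∑ y : Fin n₂ → ZMod 3, ZMod.stdAddChar (∑ i, y i * z i) = if z = 0 then (3 : ℂ) ^ n₂ else 0 := by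
  simp only [addChar_map_sum]
  rw [← Fintype.prod_sum fun i (a : ZMod 3) => (ZMod.stdAddChar (a * z i) : ℂ)]
  simp only [AddChar.sum_mulShift _ isPrimitive_stdAddChar_three]
  split_ifs with h
  · simp [h]
  · obtain ⟨i, hi⟩ := Function.ne_iff.1 h
    refine Finset.prod_eq_zero (Finset.mem_univ i) ?_
    simpa using hi

/-- The quadratic Gauss sum `∑ ξ ^ (a x²)` over `𝔽₃`. -/
noncomputable def quadGauss (a : ZMod 3) : ℂ :=
  ∑ x : ZMod 3, ZMod.stdAddChar (a * x ^ 2)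

/-- Summing over `y` first kills every `z ≠ 0`, so the coefficients `v` disappear and only the
diagonal form in `u` contributes. -/
theorem walsh_quadPlateaued_zero (u v : Fin n₁ → ZMod 3) :
    walsh (quadPlateaued s u v n₂) 0 = 3 ^ (n₂ + s) * ∏ i, quadGauss (u i) := by
  have hx (x : Fin n₁ → ZMod 3) :
      ∑ y : Fin n₂ → ZMod 3, ∑ z : Fin n₂ → ZMod 3, ∑ _t : Fin s → ZMod 3,
        (ZMod.stdAddChar (diagForm u v z x + ∑ i, y i * z i) : ℂ) =
      3 ^ (n₂ + s) * ∏ i, ZMod.stdAddChar (u i * x i ^ 2) := by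
    rw [Finset.sum_comm]
    simp only [AddChar.map_add_eq_mul, Finset.sum_const, ← Finset.smul_sum, ← Finset.mul_sum,
      sum_stdAddChar_dot]
    simp [diagForm, addChar_map_sum, pow_add]
    ring
  simp only [walsh, zero_dotProduct, sub_zero, sum_coord, quadPlateaued_sumElim, hx]
  rw [← Finset.mul_sum, ← Fintype.prod_sum fun i (a : ZMod 3) =>
    (ZMod.stdAddChar (u i * a ^ 2) : ℂ)]
  rfl

/-- Orthogonality of characters of `𝔽₃`, the three terms coming from the multiples `0, c, -c`. -/
theorem one_add_stdAddChar_add_conj (c : ZMod 3) :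
    1 + (ZMod.stdAddChar c : ℂ) + (starRingEnd ℂ) (ZMod.stdAddChar c) = if c = 0 then 3 else 0 := by
  have h := AddChar.sum_mulShift c isPrimitive_stdAddChar_three
  have hsum : ∑ x : ZMod 3, (ZMod.stdAddChar (x * c) : ℂ) =
      ZMod.stdAddChar (0 * c) + ZMod.stdAddChar (1 * c) + ZMod.stdAddChar (2 * c) :=
    Fin.sum_univ_three _
  have h2 : (2 : ZMod 3) * c = -c := (by decide : ∀ c : ZMod 3, 2 * c = -c) c
  rw [hsum, h2, zero_mul, one_mul, AddChar.map_zero_eq_one] at h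
  rw [← AddChar.map_neg_eq_conj, h]
  simp

theorem quadGauss_eq (a : ZMod 3) : quadGauss a = 1 + 2 * ZMod.stdAddChar a := by
  have hsum : quadGauss a = ZMod.stdAddChar (a * 0 ^ 2) + ZMod.stdAddChar (a * 1 ^ 2) +
      ZMod.stdAddChar (a * 2 ^ 2) :=
    Fin.sum_univ_three _
  have h2 : (2 : ZMod 3) ^ 2 = 1 := by decide
  rw [hsum, h2]
  simp
  ring

theorem conj_quadGauss {a : ZMod 3} (ha : a ≠ 0) :
    (starRingEnd ℂ) (quadGauss a) = -quadGauss a := by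
  have h := one_add_stdAddChar_add_conj a
  rw [if_neg ha] at h
  rw [quadGauss_eq, map_add, map_one, map_mul, Complex.conj_ofNat]
  linear_combination 2 * h

theorem quadGauss_sq {a : ZMod 3} (ha : a ≠ 0) : quadGauss a ^ 2 = -3 := by
  have h := one_add_stdAddChar_add_conj a
  have hmul : (ZMod.stdAddChar a : ℂ) * (starRingEnd ℂ) (ZMod.stdAddChar a) = 1 := by
    rw [← AddChar.map_neg_eq_conj, ← AddChar.map_add_eq_mul, add_neg_cancel,
      AddChar.map_zero_eq_one]
  rw [if_neg ha] at h
  rw [quadGauss_eq]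
  linear_combination 4 * (ZMod.stdAddChar a : ℂ) * h - 4 * hmul

theorem conj_walsh_quadPlateaued_zero {u : Fin n₁ → ZMod 3} (hu : ∀ i, u i ≠ 0)
    (v : Fin n₁ → ZMod 3) :
    (starRingEnd ℂ) (walsh (quadPlateaued s u v n₂) 0) =
      (-1) ^ n₁ * walsh (quadPlateaued s u v n₂) 0 := by
  rw [walsh_quadPlateaued_zero, map_mul, map_pow, Complex.conj_ofNat, map_prod]
  simp only [conj_quadGauss (hu _), Finset.prod_neg]
  simp
  ring

theorem walsh_quadPlateaued_zero_sq {u : Fin n₁ → ZMod 3} (hu : ∀ i, u i ≠ 0)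
    (v : Fin n₁ → ZMod 3) :
    walsh (quadPlateaued s u v n₂) 0 ^ 2 = 3 ^ (2 * (n₂ + s)) * (-3) ^ n₁ := by
  rw [walsh_quadPlateaued_zero, mul_pow, ← Finset.prod_pow]
  simp only [quadGauss_sq (hu _)]
  simp
  ring

theorem three_mul_card_zeros {ι : Type*} [Fintype ι] [DecidableEq ι]
    (f : (ι → ZMod 3) → ZMod 3) :
    3 * ((Finset.univ.filter fun w => f w = 0).card : ℂ) =
      3 ^ Fintype.card ι + walsh f 0 + (starRingEnd ℂ) (walsh f 0) := by
  have h : ∑ w, (1 + (ZMod.stdAddChar (f w) : ℂ) + (starRingEnd ℂ) (ZMod.stdAddChar (f w))) =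
      ∑ w, if f w = 0 then 3 else 0 :=
    Finset.sum_congr rfl fun w _ => one_add_stdAddChar_add_conj (f w)
  rw [Finset.sum_add_distrib, Finset.sum_add_distrib, ← map_sum (starRingEnd ℂ),
    ← Finset.sum_filter] at h
  simp only [Finset.sum_const, Finset.card_univ, Fintype.card_fun, ZMod.card, nsmul_eq_mul] at h
  simp only [walsh, zero_dotProduct, sub_zero]
  push_cast at h
  linear_combination -h

theorem card_coord (n₁ n₂ s : ℕ) : Fintype.card (Coord n₁ n₂ s) = n₁ + 2 * n₂ + s := by
  simp
  ring

/-- The Walsh value at `0` is purely imaginary, so it cancels against its conjugate. -/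
theorem card_zeros_of_odd {u : Fin n₁ → ZMod 3} (hu : ∀ i, u i ≠ 0) (v : Fin n₁ → ZMod 3)
    (hodd : Odd n₁) :
    (Finset.univ.filter fun w => quadPlateaued s u v n₂ w = 0).card =
      3 ^ (n₁ + 2 * n₂ + s - 1) := by
  have h := three_mul_card_zeros (quadPlateaued s u v n₂)
  have hpow : (3 : ℂ) ^ (n₁ + 2 * n₂ + s) = 3 * 3 ^ (n₁ + 2 * n₂ + s - 1) := by
    rw [← pow_succ']
    congr 1
    have := hodd.pos
    omega
  rw [conj_walsh_quadPlateaued_zero hu, hodd.neg_one_pow, card_coord, hpow] at h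
  have h' : ((Finset.univ.filter fun w => quadPlateaued s u v n₂ w = 0).card : ℂ) =
      3 ^ (n₁ + 2 * n₂ + s - 1) := by
    linear_combination h / 3
  exact_mod_cast h'

/-- Cube roots of unity avoid `-1`; hence the sign of a Walsh value is unambiguous. -/
theorem stdAddChar_three_ne_neg_one (j : ZMod 3) : (ZMod.stdAddChar j : ℂ) ≠ -1 := by
  intro h
  have h3 : (ZMod.stdAddChar j : ℂ) ^ 3 = 1 := by
    rw [← AddChar.map_nsmul_eq_pow, ← AddChar.map_zero_eq_one (ZMod.stdAddChar (N := 3))]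
    exact congrArg _ ((by decide : ∀ j : ZMod 3, 3 • j = 0) j)
  rw [h] at h3
  norm_num at h3

theorem mu_of_even {n s : ℕ} (h : Even (n + s)) : mu 3 n s = 1 := by
  obtain ⟨k, hk⟩ := h
  rw [mu, if_pos]
  rw [hk, ← two_mul, pow_mul, Nat.pow_mod]
  norm_num

theorem amplitude_of_even {n s : ℕ} (h : Even (n + s)) :
    amplitude 3 n s = 3 ^ ((n + s) / 2) := by
  obtain ⟨k, hk⟩ := h
  have hk' : ((n : ℝ) + s) / 2 = k := by
    have : (n : ℝ) + s = k + k := by exact_mod_cast hk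
    rw [this]
    ring
  rw [amplitude, hk', Real.rpow_natCast, hk, ← two_mul, Nat.mul_div_cancel_left _ two_pos]
  push_cast
  rfl

theorem walsh_eq_walshSign_mul {u : Fin n₁ → ZMod 3} (hu : ∀ i, u i ≠ 0)
    (v : Fin n₁ → ZMod 3) (heven : Even n₁) :
    walsh (quadPlateaued s u v n₂) 0 =
      walshSign (quadPlateaued s u v n₂) s 0 * 3 ^ ((n₁ + 2 * n₂ + s + s) / 2) := by
  have hev : Even (n₁ + 2 * n₂ + s + s) := by
    obtain ⟨k, rfl⟩ := heven
    exact ⟨k + n₂ + s, by ring⟩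
  set k := (n₁ + 2 * n₂ + s + s) / 2 with hk
  have hsq : walsh (quadPlateaued s u v n₂) 0 ^ 2 = (3 ^ k) ^ 2 := by
    rw [walsh_quadPlateaued_zero_sq hu, heven.neg_pow, ← pow_add, ← pow_mul]
    congr 1
    obtain ⟨l, hl⟩ := hev
    omega
  have h3 : (3 : ℂ) ^ k ≠ 0 := pow_ne_zero _ (by norm_num)
  rcases sq_eq_sq_iff_eq_or_eq_neg.1 hsq with h | h
  · have hB : (0 : Coord n₁ n₂ s → ZMod 3) ∈ BPlus (quadPlateaued s u v n₂) s := by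
      refine ⟨0, ?_⟩
      rw [card_coord, mu_of_even hev, amplitude_of_even hev, h]
      simp [hk]
    simp [walshSign, hB, h]
  -- `walshSign` tests `BPlus` first, so the negative case must exclude it.
  · have hB : (0 : Coord n₁ n₂ s → ZMod 3) ∉ BPlus (quadPlateaued s u v n₂) s := by
      rintro ⟨j, hj⟩
      rw [card_coord, mu_of_even hev, amplitude_of_even hev, h, ← hk, one_mul] at hj
      refine stdAddChar_three_ne_neg_one j (mul_left_cancel₀ h3 ?_)
      rw [← hj]
      ring
    have hB' : (0 : Coord n₁ n₂ s → ZMod 3) ∈ BMinus (quadPlateaued s u v n₂) s := by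
      refine ⟨0, ?_⟩
      rw [card_coord, mu_of_even hev, amplitude_of_even hev, h]
      simp [hk]
    simp [walshSign, hB, hB', h]

theorem card_zeros_of_even [NeZero n₁] {u : Fin n₁ → ZMod 3} (hu : ∀ i, u i ≠ 0)
    (v : Fin n₁ → ZMod 3) (heven : Even n₁) :
    ((Finset.univ.filter fun w => quadPlateaued s u v n₂ w = 0).card : ℤ) =
      3 ^ (n₁ + 2 * n₂ + s - 1) +
        2 * walshSign (quadPlateaued s u v n₂) s 0 * 3 ^ ((n₁ + 2 * n₂ + s + s) / 2 - 1) := by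
  have h := three_mul_card_zeros (quadPlateaued s u v n₂)
  have hn₁ : n₁ ≠ 0 := NeZero.ne n₁
  have hpow : (3 : ℂ) ^ (n₁ + 2 * n₂ + s) = 3 * 3 ^ (n₁ + 2 * n₂ + s - 1) := by
    rw [← pow_succ']
    congr 1
    omega
  have hpow' : (3 : ℂ) ^ ((n₁ + 2 * n₂ + s + s) / 2) =
      3 * 3 ^ ((n₁ + 2 * n₂ + s + s) / 2 - 1) := by
    rw [← pow_succ']
    congr 1
    obtain ⟨k, rfl⟩ := heven
    omega
  rw [conj_walsh_quadPlateaued_zero hu, heven.neg_one_pow, card_coord,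
    walsh_eq_walshSign_mul hu v heven, hpow, hpow'] at h
  have h' : ((Finset.univ.filter fun w => quadPlateaued s u v n₂ w = 0).card : ℂ) =
      3 ^ (n₁ + 2 * n₂ + s - 1) +
        2 * walshSign (quadPlateaued s u v n₂) s 0 * 3 ^ ((n₁ + 2 * n₂ + s + s) / 2 - 1) := by
    linear_combination h / 3
  exact_mod_cast h'

end CharacterSum

/-! ### Zeros of the quadratic plateaued functions -/

section Parts

variable {F : Type*} [Field F] {n₁ n₂ s : ℕ}

theorem xPart_add (w w' : Coord n₁ n₂ s → F) : xPart (w + w') = xPart w + xPart w' := rfl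

theorem yPart_add (w w' : Coord n₁ n₂ s → F) : yPart (w + w') = yPart w + yPart w' := rfl

theorem zPart_add (w w' : Coord n₁ n₂ s → F) : zPart (w + w') = zPart w + zPart w' := rfl

theorem xPart_single_inl (i : Fin n₁) (c : F) :
    xPart (Pi.single (Sum.inl i) c : Coord n₁ n₂ s → F) = Pi.single i c := by
  ext j
  simp [xPart, Pi.single_apply]

theorem xPart_single_inr (k : Fin n₂ ⊕ (Fin n₂ ⊕ Fin s)) (c : F) :
    xPart (Pi.single (Sum.inr k) c : Coord n₁ n₂ s → F) = 0 := by
  ext j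
  simp [xPart]

theorem yPart_single_inl (i : Fin n₁) (c : F) :
    yPart (Pi.single (Sum.inl i) c : Coord n₁ n₂ s → F) = 0 := by
  ext j
  simp [yPart]

theorem zPart_single_inl (i : Fin n₁) (c : F) :
    zPart (Pi.single (Sum.inl i) c : Coord n₁ n₂ s → F) = 0 := by
  ext j
  simp [zPart]

theorem yPart_single_y (k : Fin n₂) (c : F) :
    yPart (Pi.single (Sum.inr (Sum.inl k)) c : Coord n₁ n₂ s → F) = Pi.single k c := by
  ext j
  simp [yPart, Pi.single_apply]

theorem zPart_single_y (k : Fin n₂) (c : F) :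
    zPart (Pi.single (Sum.inr (Sum.inl k)) c : Coord n₁ n₂ s → F) = 0 := by
  ext j
  simp [zPart]

theorem yPart_single_inr_inr (k : Fin n₂ ⊕ Fin s) (c : F) :
    yPart (Pi.single (Sum.inr (Sum.inr k)) c : Coord n₁ n₂ s → F) = 0 := by
  ext j
  simp [yPart]

theorem zPart_single_z (k : Fin n₂) (c : F) :
    zPart (Pi.single (Sum.inr (Sum.inr (Sum.inl k))) c : Coord n₁ n₂ s → F) = Pi.single k c := by
  ext j
  simp [zPart, Pi.single_apply]

theorem sum_yPart_mul_zPart_inl_add_inr (i : Fin n₁) (k : Fin n₂ ⊕ (Fin n₂ ⊕ Fin s)) (c d : F) :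
    ∑ j, yPart (Pi.single (Sum.inl i) c + Pi.single (Sum.inr k) d : Coord n₁ n₂ s → F) j *
      zPart (Pi.single (Sum.inl i) c + Pi.single (Sum.inr k) d : Coord n₁ n₂ s → F) j = 0 := by
  refine Finset.sum_eq_zero fun j _ => ?_
  rcases k with k | k
  · simp [zPart_add, zPart_single_inl, zPart_single_y]
  · simp [yPart_add, yPart_single_inl, yPart_single_inr_inr]

end Parts

section Zeros

variable {F : Type*} [Field F] [DecidableEq F] {n₁ n₂ s : ℕ} {u v : Fin n₁ → F}

/-- Nonzero scaling preserves the condition `z = 0`, so the switch does not spoil homogeneity. -/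
theorem quadPlateaued_smul (c : F) (w : Coord n₁ n₂ s → F) :
    quadPlateaued s u v n₂ (c • w) = c ^ 2 * quadPlateaued s u v n₂ w := by
  rcases eq_or_ne c 0 with rfl | hc
  · simp [quadPlateaued, diagForm, xPart, yPart, zPart]
  have hz : zPart (c • w) = 0 ↔ zPart w = 0 := by
    have : zPart (c • w) = c • zPart w := rfl
    rw [this, smul_eq_zero_iff_right hc]
  simp only [quadPlateaued, diagForm, hz, mul_add, mul_ite, Finset.mul_sum]
  congr 1
  · split_ifs <;> refine Finset.sum_congr rfl fun i _ => ?_ <;> simp [xPart] <;> ring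
  · refine Finset.sum_congr rfl fun i _ => ?_
    simp [yPart, zPart]
    ring

theorem quadPlateaued_single_inl (i : Fin n₁) (c : F) :
    quadPlateaued s u v n₂ (Pi.single (Sum.inl i) c) = u i * c ^ 2 := by
  simp [quadPlateaued, diagForm, zPart_single_inl, xPart_single_inl, yPart_single_inl,
    Pi.single_apply]

theorem quadPlateaued_single_inl_add_single_inr (i : Fin n₁)
    (k : Fin n₂ ⊕ (Fin n₂ ⊕ Fin s)) (c d : F) :
    quadPlateaued s u v n₂ (Pi.single (Sum.inl i) c + Pi.single (Sum.inr k) d) = u i * c ^ 2 ∨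
    quadPlateaued s u v n₂ (Pi.single (Sum.inl i) c + Pi.single (Sum.inr k) d) = v i * c ^ 2 := by
  rw [quadPlateaued, sum_yPart_mul_zPart_inl_add_inr, diagForm]
  split_ifs
  · left
    simp [xPart_add, xPart_single_inl, xPart_single_inr, Pi.single_apply]
  · right
    simp [xPart_add, xPart_single_inl, xPart_single_inr, Pi.single_apply]

theorem quadPlateaued_single_inr [NeZero n₁] (k : Fin n₂ ⊕ (Fin n₂ ⊕ Fin s)) (c : F) :
    quadPlateaued s u v n₂ (Pi.single (Sum.inr k) c) = 0 := by
  simpa using quadPlateaued_single_inl_add_single_inr (u := u) (v := v) 0 k 0 c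

theorem quadPlateaued_alpha_ne_zero [NeZero n₁] (hu : ∀ i, u i ≠ 0) (hv : ∀ i, v i ≠ 0)
    (j : Coord n₁ n₂ s) : quadPlateaued s u v n₂ (alpha F n₁ n₂ s j) ≠ 0 := by
  rcases j with i | k
  · simpa [alpha, quadPlateaued_single_inl] using hu i
  · rcases quadPlateaued_single_inl_add_single_inr (u := u) (v := v) 0 k 1 1 with h | h
    · simpa [alpha, h] using hu 0
    · simpa [alpha, h] using hv 0

theorem quadPlateaued_single_add_single_add_single {i j k : Fin n₁} (hij : i ≠ j) (hik : i ≠ k)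
    (hjk : j ≠ k) (a b c : F) :
    quadPlateaued s u v n₂
      (Pi.single (Sum.inl i) a + Pi.single (Sum.inl j) b + Pi.single (Sum.inl k) c) =
      u i * a ^ 2 + u j * b ^ 2 + u k * c ^ 2 := by
  have hsq (l : Fin n₁) : ((Pi.single i a : Fin n₁ → F) l + (Pi.single j b : Fin n₁ → F) l +
      (Pi.single k c : Fin n₁ → F) l) ^ 2 = (Pi.single i (a ^ 2) : Fin n₁ → F) l +
        (Pi.single j (b ^ 2) : Fin n₁ → F) l + (Pi.single k (c ^ 2) : Fin n₁ → F) l := by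
    simp only [Pi.single_apply]
    by_cases h₁ : l = i
    · subst h₁
      simp [hij, hik]
    · by_cases h₂ : l = j
      · subst h₂
        simp [hij.symm, hjk]
      · simp [h₁, h₂]
  simp only [quadPlateaued, diagForm, zPart_add, xPart_add, yPart_add, zPart_single_inl,
    xPart_single_inl, yPart_single_inl, Pi.add_apply, hsq, mul_add, Finset.sum_add_distrib]
  simp [Pi.single_apply]

/-- Here `z ≠ 0` selects the coefficients `v`, and the product `y z = -v i` cancels `v i`. -/
theorem quadPlateaued_hyperbolic (i : Fin n₁) (k : Fin n₂) :
    quadPlateaued s u v n₂ (Pi.single (Sum.inl i) 1 + (Pi.single (Sum.inr (Sum.inl k)) (-v i) +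
      Pi.single (Sum.inr (Sum.inr (Sum.inl k))) 1)) = 0 := by
  have hz : (Pi.single k 1 : Fin n₂ → F) ≠ 0 := by simp
  simp [quadPlateaued, diagForm, xPart_add, yPart_add, zPart_add, xPart_single_inl,
    xPart_single_inr, yPart_single_inl, yPart_single_y, yPart_single_inr_inr, zPart_single_inl,
    zPart_single_y, zPart_single_z, hz, Pi.single_apply]

end Zeros

/-! ### The zeros span the space -/

section Span

variable {n₁ n₂ s : ℕ} {u v : Fin n₁ → ZMod 3}

theorem exists_ternary_zero (p q r : ZMod 3) (hp : p ≠ 0) (hq : q ≠ 0) (hr : r ≠ 0) :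
    ∃ y z : ZMod 3, p * 1 ^ 2 + q * y ^ 2 + r * z ^ 2 = 0 := by
  revert p q r
  decide

/-- The zeros of a quadratic plateaued function span the whole space. -/
theorem eq_zero_of_dotProduct_zeros [NeZero n₁] (hu : ∀ i, u i ≠ 0) (hn : 3 ≤ n₁ + 2 * n₂)
    {a : Coord n₁ n₂ s → ZMod 3}
    (ha : ∀ w, quadPlateaued s u v n₂ w = 0 → a ⬝ᵥ w = 0) : a = 0 := by
  have hinr (k) : a (Sum.inr k) = 0 := by
    simpa using ha _ (quadPlateaued_single_inr k 1)
  funext j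
  rcases j with i | k
  swap
  · exact hinr k
  rcases Nat.eq_zero_or_pos n₂ with hn₂ | hn₂
  · have h3 : 3 ≤ n₁ := by omega
    obtain ⟨j, k, hij, hik, hjk⟩ : ∃ j k : Fin n₁, i ≠ j ∧ i ≠ k ∧ j ≠ k := by
      obtain ⟨j, hj⟩ : ∃ j, j ∉ ({i} : Finset (Fin n₁)) :=
        Finset.exists_mem_notMem_of_card_lt_card (t := Finset.univ)
          (by simp; omega) |>.imp fun _ h => h.2
      obtain ⟨k, hk⟩ : ∃ k, k ∉ ({i, j} : Finset (Fin n₁)) :=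
        Finset.exists_mem_notMem_of_card_lt_card (t := Finset.univ)
          (Finset.card_le_two.trans_lt (by simp; omega)) |>.imp fun _ h => h.2
      simp only [Finset.mem_singleton, Finset.mem_insert, not_or] at hj hk
      exact ⟨j, k, Ne.symm hj, Ne.symm hk.1, Ne.symm hk.2⟩
    obtain ⟨y, z, hyz⟩ := exists_ternary_zero _ _ _ (hu i) (hu j) (hu k)
    -- The two zeros `(1, y, z)` and `(1, -y, -z)` add up to `2 e_i`.
    have h₁ := ha _ ((quadPlateaued_single_add_single_add_single hij hik hjk 1 y z).trans hyz)
    have h₂ := ha _ ((quadPlateaued_single_add_single_add_single hij hik hjk 1 (-y) (-z)).trans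
      (by simpa using hyz))
    simp only [dotProduct_add, dotProduct_single] at h₁ h₂
    have h2 : (2 : ZMod 3) ≠ 0 := by decide
    refine (mul_eq_zero.1 (?_ : 2 * a (Sum.inl i) = 0)).resolve_left h2
    linear_combination h₁ + h₂
  · simpa [hinr] using ha _ (quadPlateaued_hyperbolic i ⟨0, hn₂⟩)

end Span

/-! ### Second moments of the zero set -/

section Moments

variable {n₁ n₂ s : ℕ} {u v : Fin n₁ → ZMod 3}

/-- The weights for which a quadratic plateaued function has weighted degree two. -/
def coordWeight (n₁ n₂ s : ℕ) : Coord n₁ n₂ s → ℕ :=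
  Sum.elim (fun _ => 1) (Sum.elim (fun _ => 2) (Sum.elim (fun _ => 0) fun _ => 2))

theorem coordWeight_le_two (i : Coord n₁ n₂ s) : coordWeight n₁ n₂ s i ≤ 2 := by
  rcases i with i | i | i | i <;> simp [coordWeight]

theorem sum_coordWeight : ∑ i, coordWeight n₁ n₂ s i = n₁ + 2 * n₂ + 2 * s := by
  simp [coordWeight]
  ring

theorem indicator_zero_eq_prod {ι : Type*} [Fintype ι] (z : ι → ZMod 3) :
    (if z = 0 then (1 : ZMod 3) else 0) = ∏ i, (1 + -1 * (z i * z i)) := by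
  split_ifs with h
  · simp [h]
  · obtain ⟨i, hi⟩ := Function.ne_iff.1 h
    refine (Finset.prod_eq_zero (Finset.mem_univ i) ?_).symm
    exact (by decide : ∀ c : ZMod 3, c ≠ 0 → 1 + -1 * (c * c) = 0) _ hi

theorem quadPlateaued_eq_polynomial (w : Coord n₁ n₂ s → ZMod 3) :
    quadPlateaued s u v n₂ w =
      (∑ i, v i * (w (Sum.inl i) * w (Sum.inl i)) +
        (∏ k, (1 + -1 * (w (Sum.inr (Sum.inr (Sum.inl k))) * w (Sum.inr (Sum.inr (Sum.inl k)))))) *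
          ∑ i, (u i - v i) * (w (Sum.inl i) * w (Sum.inl i))) +
      ∑ k, w (Sum.inr (Sum.inl k)) * w (Sum.inr (Sum.inr (Sum.inl k))) := by
  rw [← indicator_zero_eq_prod fun k => w (Sum.inr (Sum.inr (Sum.inl k)))]
  simp only [quadPlateaued, diagForm]
  congr 1
  change (if zPart w = 0 then _ else _) = _ + (if zPart w = 0 then (1 : ZMod 3) else 0) * _
  split_ifs
  · rw [one_mul, ← Finset.sum_add_distrib]
    refine Finset.sum_congr rfl fun i _ => ?_
    simp only [xPart]
    ring
  · rw [zero_mul, add_zero]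
    refine Finset.sum_congr rfl fun i _ => ?_
    simp only [xPart]
    ring

/-- With weight 0 on `z` the indicator of `z = 0` is free, and weight 2 on `y` keeps `y z` in degree
2. The variables `t` are absent from `f`, so they may carry weight 2, bringing the total weight to
`n + s`. -/
theorem weightedDegreeLE_quadPlateaued :
    WeightedDegreeLE (coordWeight n₁ n₂ s) 2 (quadPlateaued s u v n₂) := by
  have hx (i : Fin n₁) : WeightedDegreeLE (coordWeight n₁ n₂ s) 1
      (fun w : Coord n₁ n₂ s → ZMod 3 => w (Sum.inl i)) := WeightedDegreeLE.coord (Sum.inl i)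
  have hy (k : Fin n₂) : WeightedDegreeLE (coordWeight n₁ n₂ s) 2
      (fun w : Coord n₁ n₂ s → ZMod 3 => w (Sum.inr (Sum.inl k))) :=
    WeightedDegreeLE.coord (Sum.inr (Sum.inl k))
  have hz (k : Fin n₂) : WeightedDegreeLE (coordWeight n₁ n₂ s) 0
      (fun w : Coord n₁ n₂ s → ZMod 3 => w (Sum.inr (Sum.inr (Sum.inl k)))) :=
    WeightedDegreeLE.coord (Sum.inr (Sum.inr (Sum.inl k)))
  have hquad (c : Fin n₁ → ZMod 3) : WeightedDegreeLE (coordWeight n₁ n₂ s) 2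
      (fun w : Coord n₁ n₂ s → ZMod 3 => ∑ i, c i * (w (Sum.inl i) * w (Sum.inl i))) :=
    .sum _ fun i _ => .const_mul (c i) ((hx i).mul (hx i))
  have hprod : WeightedDegreeLE (coordWeight n₁ n₂ s) 0 (fun w : Coord n₁ n₂ s → ZMod 3 =>
      ∏ k, (1 + -1 * (w (Sum.inr (Sum.inr (Sum.inl k))) * w (Sum.inr (Sum.inr (Sum.inl k)))))) :=
    .prod_zero _ fun k _ => (WeightedDegreeLE.const 1).add (.const_mul _ ((hz k).mul (hz k)))
  rw [funext quadPlateaued_eq_polynomial]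
  exact ((hquad v).add (hprod.mul (hquad fun i => u i - v i))).add
    (.sum _ fun k _ => (hy k).mul (hz k))

/-- The second moments of the zero set of a quadratic plateaued function vanish. -/
theorem sum_zeros_mul_eq_zero (hn : 5 ≤ n₁ + 2 * n₂ + 2 * s) (i j : Coord n₁ n₂ s) :
    ∑ w with quadPlateaued s u v n₂ w = 0, w i * w j = 0 := by
  have hf := weightedDegreeLE_quadPlateaued (n₂ := n₂) (s := s) (u := u) (v := v)
  -- `8 = 2·2 + 2 + 2`, to be compared with `2 (n₁ + 2n₂ + 2s) ≥ 10`; the factor `1 - f²` is the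
  -- indicator of the zero set.
  have hdeg : WeightedDegreeLE (coordWeight n₁ n₂ s) 8 fun w : Coord n₁ n₂ s → ZMod 3 =>
      (1 + -1 * (quadPlateaued s u v n₂ w * quadPlateaued s u v n₂ w)) * (w i * w j) :=
    ((WeightedDegreeLE.const 1).add (.const_mul (-1) (hf.mul hf))).mul
      (((WeightedDegreeLE.coord i).mono (coordWeight_le_two i)).mul
        ((WeightedDegreeLE.coord j).mono (coordWeight_le_two j)))
  refine Eq.trans ?_ (hdeg.sum_eq_zero (by rw [ZMod.card, sum_coordWeight]; omega))
  rw [Finset.sum_filter]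
  refine Finset.sum_congr rfl fun w _ => ?_
  rw [(by decide : ∀ c : ZMod 3, 1 + -1 * (c * c) = if c = 0 then 1 else 0), ite_mul, one_mul,
    zero_mul]

end Moments

/-! ### Transversals of the zero set and the LCD codes -/

section Transversal

variable {ι : Type*} {T D : Set (ι → ZMod 3)}

theorem eq_one_or_eq_neg_one_of_ne_zero {a : ZMod 3} (ha : a ≠ 0) : a = 1 ∨ a = -1 := by
  revert a
  decide

theorem IsScalarTransversal.mem_iff (h : IsScalarTransversal T D) {w : ι → ZMod 3} :
    w ∈ D ↔ w ∈ T ∨ -w ∈ T := by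
  rw [← h.2]
  simp only [Set.mem_iUnion, Set.mem_image, Set.mem_ofPred_eq, exists_prop]
  constructor
  · rintro ⟨a, ha, x, hx, rfl⟩
    rcases eq_one_or_eq_neg_one_of_ne_zero ha with rfl | rfl
    · simp [hx]
    · simp [hx]
  · rintro (hw | hw)
    · exact ⟨1, one_ne_zero, w, hw, one_smul _ w⟩
    · exact ⟨-1, by decide, -w, hw, by simp⟩

theorem IsScalarTransversal.neg_notMem (h : IsScalarTransversal T D) {w : ι → ZMod 3}
    (hw : w ∈ T) : -w ∉ T := by
  intro hw'
  refine Set.disjoint_left.1 (h.1 1 (-1) one_ne_zero (by decide) (by decide))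
    ⟨w, hw, one_smul _ w⟩ ⟨-w, hw', by simp⟩

theorem IsScalarTransversal.exists_smul (h : IsScalarTransversal T D) {w : ι → ZMod 3}
    (hw : w ∈ D) : ∃ τ ∈ T, ∃ c : ZMod 3, w = c • τ := by
  rcases h.mem_iff.1 hw with hw | hw
  · exact ⟨w, hw, 1, (one_smul _ w).symm⟩
  · exact ⟨-w, hw, -1, by simp⟩

variable [Fintype ι] [DecidableEq ι] {f : (ι → ZMod 3) → ZMod 3} {T : Finset (ι → ZMod 3)}

/-- The zero set is the disjoint union of `{0}`, `T` and `-T`. -/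
theorem IsScalarTransversal.sum_zeros {M : Type*} [AddCommMonoid M]
    (h : IsScalarTransversal (T : Set (ι → ZMod 3)) (nonzeroZeros f)) (hf : f 0 = 0)
    (g : (ι → ZMod 3) → M) (hg : ∀ w, g (-w) = g w) :
    ∑ w with f w = 0, g w = g 0 + 2 • ∑ w ∈ T, g w := by
  have h0 : (0 : ι → ZMod 3) ∉ T ∪ T.image Neg.neg := by
    intro h0
    have : (0 : ι → ZMod 3) ∈ nonzeroZeros f := h.mem_iff.2 (by simpa using h0)
    exact this.2 rfl
  have hdisj : Disjoint T (T.image Neg.neg) := by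
    rw [Finset.disjoint_left]
    intro w hw hw'
    obtain ⟨x, hx, rfl⟩ := Finset.mem_image.1 hw'
    exact h.neg_notMem (Finset.mem_coe.2 hx) hw
  have hset : (Finset.univ.filter fun w => f w = 0) = insert 0 (T ∪ T.image Neg.neg) := by
    ext w
    have hmem := h.mem_iff (w := w)
    simp only [nonzeroZeros, Set.mem_ofPred_eq, Finset.mem_coe] at hmem
    simp only [Finset.mem_filter, Finset.mem_univ, true_and, Finset.mem_insert, Finset.mem_union,
      Finset.mem_image, neg_eq_iff_eq_neg, exists_eq_right, ← hmem]
    by_cases hw : w = 0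
    · simp [hw, hf]
    · simp [hw]
  rw [hset, Finset.sum_insert h0, Finset.sum_union hdisj,
    Finset.sum_image fun x _ y _ hxy => neg_injective hxy, two_smul]
  simp only [hg]

end Transversal

/-! ### Factorization of the generator matrix -/

section LCD

variable {F : Type*} [Field F] {n₁ n₂ s : ℕ} [NeZero n₁]

/-- The matrix with rows `α_i`. -/
noncomputable def alphaMatrix (F : Type*) [Field F] (n₁ n₂ s : ℕ) [NeZero n₁] :
    Matrix (Coord n₁ n₂ s) (Coord n₁ n₂ s) F :=
  Matrix.of (alpha F n₁ n₂ s)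

/-- The matrix whose columns are the elements of `T`. -/
def pointMatrix {ι : Type*} (T : Finset (ι → F)) : Matrix ι T F :=
  Matrix.of fun i w => w.1 i

theorem isUnit_alphaMatrix : IsUnit (alphaMatrix F n₁ n₂ s) := by
  rw [← Matrix.mulVec_injective_iff_isUnit]
  refine (injective_iff_map_eq_zero' (alphaMatrix F n₁ n₂ s).mulVecLin).2 fun a => ⟨fun h => ?_, ?_⟩
  swap
  · rintro rfl
    simp
  have hrow (j) : alpha F n₁ n₂ s j ⬝ᵥ a = 0 := congrFun h j
  have hinl (i) : a (Sum.inl i) = 0 := by simpa [alpha] using hrow (Sum.inl i)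
  funext j
  rcases j with i | k
  · exact hinl i
  · simpa [alpha, hinl] using hrow (Sum.inr k)

theorem gram_alpha :
    gram (alpha F n₁ n₂ s) = alphaMatrix F n₁ n₂ s * (alphaMatrix F n₁ n₂ s)ᵀ :=
  rfl

theorem definingSetMatrix_alpha (T : Finset (Coord n₁ n₂ s → F)) :
    definingSetMatrix (alpha F n₁ n₂ s) T = alphaMatrix F n₁ n₂ s * pointMatrix T :=
  rfl

theorem definingSetCode_eq_rowCode {ι : Type*} [Fintype ι] (T : Finset (ι → F)) :
    definingSetCode T = rowCode (pointMatrix T) := by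
  ext c
  rw [mem_rowCode]
  exact exists_congr fun a => eq_comm

/-- `G'` factors through the matrix whose columns are the `α_i` and the elements of `T`. -/
theorem fromCols_gram_definingSetMatrix (T : Finset (Coord n₁ n₂ s → F)) :
    Matrix.fromCols (gram (alpha F n₁ n₂ s)) (definingSetMatrix (alpha F n₁ n₂ s) T) =
      alphaMatrix F n₁ n₂ s * Matrix.fromCols (alphaMatrix F n₁ n₂ s)ᵀ (pointMatrix T) := by
  rw [gram_alpha, definingSetMatrix_alpha, Matrix.mul_fromCols]

theorem smul_alpha_add_smul_alpha {i j : Coord n₁ n₂ s} (hij : i ≠ j) {a b : F}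
    (h : a • alpha F n₁ n₂ s i + b • alpha F n₁ n₂ s j = 0) : a = 0 ∧ b = 0 := by
  have hinj := Matrix.vecMul_injective_iff_isUnit.2 (isUnit_alphaMatrix (F := F) (n₁ := n₁)
    (n₂ := n₂) (s := s))
  have h0 : (Pi.single i a + Pi.single j b : Coord n₁ n₂ s → F) = 0 := by
    refine hinj ?_
    simp only [Matrix.add_vecMul, Matrix.single_vecMul, Matrix.zero_vecMul]
    exact h
  have hi := congrFun h0 i
  have hj := congrFun h0 j
  simp [hij, hij.symm] at hi hj
  exact ⟨hi, hj⟩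

end LCD

/-! ### Size and Gram matrix of the transversal -/

section Count

variable {n₁ n₂ s : ℕ} {u v : Fin n₁ → ZMod 3} {T : Finset (Coord n₁ n₂ s → ZMod 3)}

theorem two_mul_card_transversal_add_one
    (hT : IsScalarTransversal (T : Set (Coord n₁ n₂ s → ZMod 3))
      (nonzeroZeros (quadPlateaued s u v n₂))) :
    2 * T.card + 1 = (Finset.univ.filter fun w => quadPlateaued s u v n₂ w = 0).card := by
  have hf0 : quadPlateaued s u v n₂ 0 = 0 := by
    simpa using quadPlateaued_smul (u := u) (v := v) (0 : ZMod 3) (0 : Coord n₁ n₂ s → ZMod 3)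
  have h := hT.sum_zeros hf0 (fun _ => 1) (fun _ => rfl)
  simp only [Finset.sum_const, smul_eq_mul, mul_one] at h
  rw [h, add_comm]

theorem pointMatrix_mul_transpose (hn : 5 ≤ n₁ + 2 * n₂ + 2 * s)
    (hT : IsScalarTransversal (T : Set (Coord n₁ n₂ s → ZMod 3))
      (nonzeroZeros (quadPlateaued s u v n₂))) :
    pointMatrix T * (pointMatrix T)ᵀ = 0 := by
  ext i j
  have hf0 : quadPlateaued s u v n₂ 0 = 0 := by
    simpa using quadPlateaued_smul (u := u) (v := v) (0 : ZMod 3) (0 : Coord n₁ n₂ s → ZMod 3)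
  have h := hT.sum_zeros hf0 (fun w => w i * w j) (by simp)
  rw [sum_zeros_mul_eq_zero hn] at h
  have hsum : (pointMatrix T * (pointMatrix T)ᵀ) i j = ∑ w ∈ T, w i * w j :=
    Finset.sum_coe_sort T fun w => w i * w j
  rw [hsum, Matrix.zero_apply]
  refine (by decide : ∀ c : ZMod 3, 0 = 2 • c → c = 0) _ ?_
  simpa using h

end Count

/-! ### Parity-check columns and code parameters -/

section Main

variable {n₁ n₂ s : ℕ} [NeZero n₁] {u v : Fin n₁ → ZMod 3}
  {T : Finset (Coord n₁ n₂ s → ZMod 3)}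

theorem linearIndependent_row_pointMatrix (hu : ∀ i, u i ≠ 0) (hn : 3 ≤ n₁ + 2 * n₂)
    (hT : IsScalarTransversal (T : Set (Coord n₁ n₂ s → ZMod 3))
      (nonzeroZeros (quadPlateaued s u v n₂))) :
    LinearIndependent (ZMod 3) (pointMatrix T).row := by
  rw [← Matrix.vecMul_injective_iff]
  refine (injective_iff_map_eq_zero' (pointMatrix T).vecMulLinear).2 fun a => ⟨fun h => ?_, ?_⟩
  swap
  · rintro rfl
    simp
  refine eq_zero_of_dotProduct_zeros (v := v) hu hn fun w hw => ?_
  by_cases hw0 : w = 0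
  · simp [hw0]
  obtain ⟨τ, hτ, c, rfl⟩ := hT.exists_smul (w := w) ⟨hw, hw0⟩
  have hτ0 : a ⬝ᵥ τ = 0 := congrFun h ⟨τ, hτ⟩
  rw [dotProduct_smul, hτ0, smul_zero]

theorem isUnit_fromCols_mul_transpose (hn : 5 ≤ n₁ + 2 * n₂ + 2 * s)
    (hT : IsScalarTransversal (T : Set (Coord n₁ n₂ s → ZMod 3))
      (nonzeroZeros (quadPlateaued s u v n₂))) :
    IsUnit (Matrix.fromCols (gram (alpha (ZMod 3) n₁ n₂ s))
      (definingSetMatrix (alpha (ZMod 3) n₁ n₂ s) T) *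
      (Matrix.fromCols (gram (alpha (ZMod 3) n₁ n₂ s))
        (definingSetMatrix (alpha (ZMod 3) n₁ n₂ s) T))ᵀ) := by
  have hA := isUnit_alphaMatrix (F := ZMod 3) (n₁ := n₁) (n₂ := n₂) (s := s)
  have hA' : IsUnit (alphaMatrix (ZMod 3) n₁ n₂ s)ᵀ := (Matrix.isUnit_transpose _).2 hA
  rw [fromCols_gram_definingSetMatrix, Matrix.transpose_mul, Matrix.transpose_fromCols,
    Matrix.mul_assoc, ← Matrix.mul_assoc (Matrix.fromCols _ _), Matrix.fromCols_mul_fromRows,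
    pointMatrix_mul_transpose hn hT, add_zero, Matrix.transpose_transpose]
  exact hA.mul ((hA'.mul hA).mul hA')

theorem linearIndependent_columns (hu : ∀ i, u i ≠ 0) (hv : ∀ i, v i ≠ 0)
    (hT : IsScalarTransversal (T : Set (Coord n₁ n₂ s → ZMod 3))
      (nonzeroZeros (quadPlateaued s u v n₂)))
    (i j : Coord n₁ n₂ s ⊕ T) (hij : i ≠ j) (a b : ZMod 3)
    (h : a • (Matrix.fromCols (alphaMatrix (ZMod 3) n₁ n₂ s)ᵀ (pointMatrix T)).col i +
      b • (Matrix.fromCols (alphaMatrix (ZMod 3) n₁ n₂ s)ᵀ (pointMatrix T)).col j = 0) :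
    a = 0 ∧ b = 0 := by
  have hmem (τ : T) : quadPlateaued s u v n₂ τ = 0 ∧ (τ : Coord n₁ n₂ s → ZMod 3) ≠ 0 :=
    hT.mem_iff.2 (Or.inl τ.2)
  have hmixed (k : Coord n₁ n₂ s) (τ : T) (c d : ZMod 3)
      (h : c • alpha (ZMod 3) n₁ n₂ s k + d • (τ : Coord n₁ n₂ s → ZMod 3) = 0) :
      c = 0 ∧ d = 0 := by
    -- Applying `f` to `c α_k = -d τ` gives `c² f(α_k) = 0`, while `f(α_k) ≠ 0`.
    have hc : c = 0 := by
      have hz := congrArg (quadPlateaued s u v n₂) (eq_neg_of_add_eq_zero_left h)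
      rw [← neg_smul, quadPlateaued_smul, quadPlateaued_smul, (hmem τ).1, mul_zero] at hz
      simpa [quadPlateaued_alpha_ne_zero hu hv] using hz
    subst hc
    simpa [(hmem τ).2] using h
  rcases i with i | i <;> rcases j with j | j
  · exact smul_alpha_add_smul_alpha (fun h => hij (congrArg _ h)) h
  · exact hmixed i j a b h
  · exact (hmixed j i b a ((add_comm _ _).trans h)).symm
  · have hne : (i : Coord n₁ n₂ s → ZMod 3) ≠ j := fun h => hij (congrArg _ (Subtype.ext h))
    have h' : a • (i : Coord n₁ n₂ s → ZMod 3) + b • (j : Coord n₁ n₂ s → ZMod 3) = 0 := h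
    have hneg : -(j : Coord n₁ n₂ s → ZMod 3) ∉ T := hT.neg_notMem j.2
    have hi0 := (hmem i).2
    have hj0 := (hmem j).2
    by_cases ha : a = 0
    · subst ha
      simpa [hj0] using h'
    by_cases hb : b = 0
    · subst hb
      simpa [hi0] using h'
    exfalso
    rcases eq_one_or_eq_neg_one_of_ne_zero ha with rfl | rfl <;>
      rcases eq_one_or_eq_neg_one_of_ne_zero hb with rfl | rfl <;>
      simp only [one_smul, neg_smul] at h'
    · exact hneg (eq_neg_of_add_eq_zero_left h' ▸ i.2)
    · exact hne (add_neg_eq_zero.1 h')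
    · exact hne (neg_add_eq_zero.1 h')
    · exact hneg (neg_add_eq_zero.1 h' ▸ i.2)

/-- Three of the vectors `α_i` and of the elements of `T` are linearly dependent. -/
def HasDependentTriple (T : Finset (Coord n₁ n₂ s → ZMod 3)) : Prop :=
  ∃ i j k : Coord n₁ n₂ s ⊕ T, i ≠ j ∧ i ≠ k ∧ ∃ a b c : ZMod 3, a ≠ 0 ∧
    a • (Matrix.fromCols (alphaMatrix (ZMod 3) n₁ n₂ s)ᵀ (pointMatrix T)).col i +
    b • (Matrix.fromCols (alphaMatrix (ZMod 3) n₁ n₂ s)ᵀ (pointMatrix T)).col j +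
    c • (Matrix.fromCols (alphaMatrix (ZMod 3) n₁ n₂ s)ᵀ (pointMatrix T)).col k = 0

theorem hasDependentTriple_of_alpha_alpha {i j : Coord n₁ n₂ s} (hij : i ≠ j) {b c : ZMod 3}
    {τ : Coord n₁ n₂ s → ZMod 3} (hτ : τ ∈ T)
    (h : alpha (ZMod 3) n₁ n₂ s i + b • alpha (ZMod 3) n₁ n₂ s j = c • τ) :
    HasDependentTriple T := by
  refine ⟨Sum.inl i, Sum.inl j, Sum.inr ⟨τ, hτ⟩, Sum.inl_injective.ne hij, Sum.inl_ne_inr,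
    1, b, -c, one_ne_zero, ?_⟩
  change (1 : ZMod 3) • alpha (ZMod 3) n₁ n₂ s i + b • alpha (ZMod 3) n₁ n₂ s j + -c • τ = 0
  rw [one_smul, h, neg_smul, add_neg_cancel]

theorem hasDependentTriple_of_alpha {i : Coord n₁ n₂ s} {a b c : ZMod 3} (ha : a ≠ 0)
    {τ τ' : Coord n₁ n₂ s → ZMod 3} (hτ : τ ∈ T) (hτ' : τ' ∈ T)
    (h : a • alpha (ZMod 3) n₁ n₂ s i + b • τ = c • τ') : HasDependentTriple T := by
  refine ⟨Sum.inl i, Sum.inr ⟨τ, hτ⟩, Sum.inr ⟨τ', hτ'⟩, Sum.inl_ne_inr, Sum.inl_ne_inr,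
    a, b, -c, ha, ?_⟩
  change a • alpha (ZMod 3) n₁ n₂ s i + b • τ + -c • τ' = 0
  rw [h, neg_smul, add_neg_cancel]

/-- The difference `α_k - α_1 = e_k` is a zero of `f`. -/
theorem hasDependentTriple_of_inr (k : Fin n₂ ⊕ (Fin n₂ ⊕ Fin s))
    (hT : IsScalarTransversal (T : Set (Coord n₁ n₂ s → ZMod 3))
      (nonzeroZeros (quadPlateaued s u v n₂))) : HasDependentTriple T := by
  obtain ⟨τ, hτ, c, hc⟩ := hT.exists_smul (w := Pi.single (Sum.inr k) 1)
    ⟨quadPlateaued_single_inr k 1, by simp⟩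
  refine hasDependentTriple_of_alpha_alpha (i := Sum.inr k) (j := Sum.inl 0) (b := -1) (c := c)
    Sum.inr_ne_inl hτ ?_
  rw [← hc, neg_smul, one_smul]
  simp only [alpha]
  abel

theorem hasDependentTriple_of_add_eq_zero {i j k : Fin n₁} (hij : i ≠ j) (hik : i ≠ k)
    (hjk : j ≠ k) (huij : u i + u j = 0)
    (hT : IsScalarTransversal (T : Set (Coord n₁ n₂ s → ZMod 3))
      (nonzeroZeros (quadPlateaued s u v n₂))) : HasDependentTriple T := by
  -- The index `k`, with coefficient 0, only serves to reuse the three-term formula.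
  have hval := quadPlateaued_single_add_single_add_single (s := s) (n₂ := n₂) (u := u) (v := v)
    hij hik hjk 1 1 0
  obtain ⟨τ, hτ, c, hc⟩ := hT.exists_smul ⟨hval.trans (by simpa using huij),
    fun h => by simpa [hij] using congrFun h (Sum.inl i)⟩
  refine hasDependentTriple_of_alpha_alpha (i := Sum.inl i) (j := Sum.inl j) (b := 1) (c := c)
    (Sum.inl_injective.ne hij) hτ ?_
  rw [← hc, one_smul, Pi.single_zero, add_zero]
  rfl

/-- If `u i` cancels neither `u j` nor `u k`, all three are equal and sum to 0. Then `e_i + e_j +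
e_k` and `e_i + e_j - e_k` are both zeros, differing by `2 α_k`. -/
theorem hasDependentTriple_of_three {i j k : Fin n₁} (hij : i ≠ j) (hik : i ≠ k)
    (hjk : j ≠ k) (hu : ∀ i, u i ≠ 0)
    (hT : IsScalarTransversal (T : Set (Coord n₁ n₂ s → ZMod 3))
      (nonzeroZeros (quadPlateaued s u v n₂))) : HasDependentTriple T := by
  by_cases h₁ : u i + u j = 0
  · exact hasDependentTriple_of_add_eq_zero hij hik hjk h₁ hT
  by_cases h₂ : u i + u k = 0
  · exact hasDependentTriple_of_add_eq_zero hik hij hjk.symm h₂ hT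
  have hsum : u i + u j + u k = 0 :=
    (by decide : ∀ a b c : ZMod 3, a ≠ 0 → b ≠ 0 → c ≠ 0 → a + b ≠ 0 → a + c ≠ 0 →
      a + b + c = 0) _ _ _ (hu i) (hu j) (hu k) h₁ h₂
  have hex (d : ZMod 3) (hd : d ^ 2 = 1) := hT.exists_smul
    ⟨(quadPlateaued_single_add_single_add_single hij hik hjk 1 1 d).trans
      (by simpa [hd] using hsum), fun h => by simpa [hij, hik] using congrFun h (Sum.inl i)⟩
  obtain ⟨τ, hτ, c, hc⟩ := hex 1 (one_pow 2)
  obtain ⟨τ', hτ', c', hc'⟩ := hex (-1) (neg_one_sq)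
  refine hasDependentTriple_of_alpha (i := Sum.inl k) (a := -2) (b := c) (c := c') (by decide)
    hτ hτ' ?_
  rw [← hc, ← hc', neg_smul, two_smul, Pi.single_neg]
  simp only [alpha]
  abel

theorem hasDependentTriple (hu : ∀ i, u i ≠ 0) (hn : 5 ≤ n₁ + 2 * n₂ + 2 * s)
    (hT : IsScalarTransversal (T : Set (Coord n₁ n₂ s → ZMod 3))
      (nonzeroZeros (quadPlateaued s u v n₂))) : HasDependentTriple T := by
  rcases Nat.eq_zero_or_pos n₂ with hn₂ | hn₂
  · rcases Nat.eq_zero_or_pos s with hs | hs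
    · exact hasDependentTriple_of_three (i := ⟨0, by omega⟩) (j := ⟨1, by omega⟩)
        (k := ⟨2, by omega⟩) (by simp) (by simp) (by simp) hu hT
    · exact hasDependentTriple_of_inr (Sum.inr (Sum.inr ⟨0, hs⟩)) hT
  · exact hasDependentTriple_of_inr (Sum.inl ⟨0, hn₂⟩) hT

/-- The properties of the codes that do not involve the number of zeros. -/
theorem lcd_properties (hu : ∀ i, u i ≠ 0) (hv : ∀ i, v i ≠ 0) (hn : 3 ≤ n₁ + 2 * n₂)
    (hns : 5 ≤ n₁ + 2 * n₂ + 2 * s)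
    (hT : IsScalarTransversal (T : Set (Coord n₁ n₂ s → ZMod 3))
      (nonzeroZeros (quadPlateaued s u v n₂)))
    {G' : Matrix (Coord n₁ n₂ s) (Coord n₁ n₂ s ⊕ T) (ZMod 3)}
    (hG' : G' = Matrix.fromCols (gram (alpha (ZMod 3) n₁ n₂ s))
      (definingSetMatrix (alpha (ZMod 3) n₁ n₂ s) T)) :
    IsGeneratorMatrix (definingSetMatrix (alpha (ZMod 3) n₁ n₂ s) T) (definingSetCode T) ∧
      IsGeneratorMatrix G' (rowCode G') ∧
      HasParams (rowCode G') (T.card + (n₁ + 2 * n₂ + s)) (n₁ + 2 * n₂ + s) ∧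
      IsLCD (rowCode G') ∧
      HasParams (dualCode (rowCode G')) (T.card + (n₁ + 2 * n₂ + s)) T.card ∧
      IsMinDist (dualCode (rowCode G')) 3 ∧
      IsLCD (dualCode (rowCode G')) := by
  have hA := isUnit_alphaMatrix (F := ZMod 3) (n₁ := n₁) (n₂ := n₂) (s := s)
  have hW := linearIndependent_row_pointMatrix hu hn hT
  have hgen : IsGeneratorMatrix G' (rowCode G') := by
    refine ⟨?_, rfl⟩
    rw [← Matrix.vecMul_injective_iff, hG']
    intro c d hcd
    have hG := linearIndependent_row_mul hA hW
    rw [← definingSetMatrix_alpha, ← Matrix.vecMul_injective_iff] at hG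
    -- The columns indexed by `T` alone already force independence.
    refine hG (funext fun τ => ?_)
    exact congrFun hcd (Sum.inr τ)
  have hcard : Fintype.card (Coord n₁ n₂ s ⊕ T) = T.card + (n₁ + 2 * n₂ + s) := by
    rw [Fintype.card_sum, card_coord, Fintype.card_coe, add_comm]
  have hfin : Module.finrank (ZMod 3) (rowCode G') = n₁ + 2 * n₂ + s := by
    rw [hgen.finrank, card_coord]
  have hlcd : IsLCD (rowCode G') :=
    isLCD_rowCode (by rw [hG']; exact isUnit_fromCols_mul_transpose hns hT)
  have hnt : Nontrivial (Coord n₁ n₂ s ⊕ T) := by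
    rw [← Fintype.one_lt_card_iff_nontrivial, hcard]
    omega
  refine ⟨⟨?_, ?_⟩, hgen, ⟨hcard, hfin⟩, hlcd, ⟨hcard, ?_⟩, ?_, hlcd.dualCode⟩
  · rw [definingSetMatrix_alpha]
    exact linearIndependent_row_mul hA hW
  · rw [definingSetMatrix_alpha, rowCode_mul hA, definingSetCode_eq_rowCode]
  · have := finrank_add_finrank_dualCode (rowCode G')
    omega
  -- The invertible left factor `A` is dropped, leaving a parity-check matrix whose columns are the
  -- `α_i` and the points of `T`.
  · refine isMinDist_three (B := Matrix.fromCols (alphaMatrix (ZMod 3) n₁ n₂ s)ᵀ (pointMatrix T))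
      (fun x => ?_) (linearIndependent_columns hu hv hT) (hasDependentTriple hu hns hT)
    rw [mem_dualCode_rowCode, hG', fromCols_gram_definingSetMatrix, ← Matrix.mulVec_mulVec]
    exact ⟨fun h => Matrix.mulVec_injective_iff_isUnit.2 hA (h.trans (Matrix.mulVec_zero _).symm),
      fun h => by rw [h, Matrix.mulVec_zero]⟩

end Main

end PlateauedLCD

theorem theorem11 (n₁ n₂ s n : ℕ) [NeZero n₁] (hn : n = n₁ + 2 * n₂ + s)
    (u v : Fin n₁ → ZMod 3) (hu : ∀ i, u i ≠ 0) (hv : ∀ i, v i ≠ 0)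
    (f : (PlateauedLCD.Coord n₁ n₂ s → ZMod 3) → ZMod 3)
    (hf : f = PlateauedLCD.quadPlateaued s u v n₂)
    (T : Finset (PlateauedLCD.Coord n₁ n₂ s → ZMod 3))
    (hT : PlateauedLCD.IsScalarTransversal (T : Set (PlateauedLCD.Coord n₁ n₂ s → ZMod 3))
      (PlateauedLCD.nonzeroZeros f))
    (H : Matrix (PlateauedLCD.Coord n₁ n₂ s) (PlateauedLCD.Coord n₁ n₂ s) (ZMod 3))
    (hH : H = PlateauedLCD.gram (PlateauedLCD.alpha (ZMod 3) n₁ n₂ s))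
    (G : Matrix (PlateauedLCD.Coord n₁ n₂ s) T (ZMod 3))
    (hG : G = PlateauedLCD.definingSetMatrix (PlateauedLCD.alpha (ZMod 3) n₁ n₂ s) T)
    (C : Submodule (ZMod 3) (PlateauedLCD.Coord n₁ n₂ s ⊕ T → ZMod 3))
    (hC : C = PlateauedLCD.rowCode (Matrix.fromCols H G)) :
    (Even (n + s) → s + 4 ≤ n → 6 ≤ n + s →
      PlateauedLCD.IsGeneratorMatrix G (PlateauedLCD.definingSetCode T) ∧
      PlateauedLCD.IsGeneratorMatrix (Matrix.fromCols H G) C ∧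
      ∃ m : ℕ,
        (2 * m : ℤ) =
          3 ^ (n - 1) + 2 * PlateauedLCD.walshSign f s 0 * 3 ^ ((n + s) / 2 - 1) - 1 ∧
        PlateauedLCD.HasParams C (m + n) n ∧
        PlateauedLCD.IsLCD C ∧
        PlateauedLCD.HasParams (PlateauedLCD.dualCode C) (m + n) m ∧
        PlateauedLCD.IsMinDist (PlateauedLCD.dualCode C) 3 ∧
        PlateauedLCD.IsLCD (PlateauedLCD.dualCode C)) ∧
    (Odd (n + s) → s + 3 ≤ n → 5 ≤ n + s →
      PlateauedLCD.IsGeneratorMatrix G (PlateauedLCD.definingSetCode T) ∧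
      PlateauedLCD.IsGeneratorMatrix (Matrix.fromCols H G) C ∧
      ∃ m : ℕ,
        (2 * m : ℤ) = 3 ^ (n - 1) - 1 ∧
        PlateauedLCD.HasParams C (m + n) n ∧
        PlateauedLCD.IsLCD C ∧
        PlateauedLCD.HasParams (PlateauedLCD.dualCode C) (m + n) m ∧
        PlateauedLCD.IsMinDist (PlateauedLCD.dualCode C) 3 ∧
        PlateauedLCD.IsLCD (PlateauedLCD.dualCode C)) := by
  subst hn hf hH hG hC
  constructor
  · intro heven hs hns
    obtain ⟨h₁, h₂, h₃⟩ := PlateauedLCD.lcd_properties hu hv (by omega) (by omega) hT rfl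
    refine ⟨h₁, h₂, T.card, ?_, h₃⟩
    -- `n + s = n₁ + 2(n₂ + s)`.
    have heven₁ : Even n₁ := by
      rw [Nat.even_iff] at heven ⊢
      omega
    have hcard := PlateauedLCD.two_mul_card_transversal_add_one hT
    rw [← PlateauedLCD.card_zeros_of_even hu v heven₁, ← hcard]
    push_cast
    ring
  · intro hodd hs hns
    obtain ⟨h₁, h₂, h₃⟩ := PlateauedLCD.lcd_properties hu hv (by omega) (by omega) hT rfl
    refine ⟨h₁, h₂, T.card, ?_, h₃⟩
    have hodd₁ : Odd n₁ := by
      rw [Nat.odd_iff] at hodd ⊢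
      omega
    have hcard := PlateauedLCD.two_mul_card_transversal_add_one hT
    rw [PlateauedLCD.card_zeros_of_odd hu v hodd₁] at hcard
    have : (2 * T.card + 1 : ℤ) = 3 ^ (n₁ + 2 * n₂ + s - 1) := by exact_mod_cast hcard
    linarith
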